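/- Let $n\ge 2$ and let $r_1,\dots,r_n$ be nonnegative integers. Let $v_1,\dots,v_{2n+1}$ be the vertices of the path $P_{2n+1}$, labelled consecutively starting from one endpoint. Let $C(r_1,\dots,r_n)$ be the tree obtained from $P_{2n+1}$ by attaching $r_i$ new pendant vertices to $v_{2i}$ for each $i=1,\dots,n$. Let $S(r_1,\dots,r_n)$ be the tree obtained from $C(r_1,\dots,r_n)$ by attaching one new pendant vertex to each vertex of degree $1$ of $C(r_1,\dots,r_n)$ and to each of the odd-indexed vertices $v_3,v_5,\dots,v_{2n-1}$. Then $S(r_1,\dots,r_n)$ is not integral; that is, some eigenvalue of its adjacency matrix is not an integer. -/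

import Mathlib

namespace IntegralTrees

/-- A finite simple graph is integral if every eigenvalue of its (real symmetric) adjacency
matrix is an integer. -/
def IntegralGraph {V : Type*} [Fintype V] (G : SimpleGraph V) : Prop :=
  open Classical in
  ∀ μ : ℝ, Module.End.HasEigenvalue (Matrix.toLin' (G.adjMatrix ℝ)) μ → ∃ m : ℤ, μ = (m : ℝ)

/-- The graph obtained from `G` by adding, for each `e : ι`, one new vertex whose only neighbor
is the vertex `f e` of `G`. -/
def attach {V ι : Type*} (G : SimpleGraph V) (f : ι → V) : SimpleGraph (V ⊕ ι) where
  Adj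
    | Sum.inl u, Sum.inl v => G.Adj u v
    | Sum.inl u, Sum.inr e => u = f e
    | Sum.inr e, Sum.inl u => u = f e
    | Sum.inr _, Sum.inr _ => False
  symm := ⟨by
    rintro (u | e) (v | e') h
    · exact G.adj_symm h
    · exact h
    · exact h
    · exact h⟩
  loopless := ⟨by
    rintro (u | e) h
    · exact G.loopless.irrefl u h
    · exact h⟩

instance {V ι : Type*} [DecidableEq V] (G : SimpleGraph V) [DecidableRel G.Adj] (f : ι → V) :
    DecidableRel (attach G f).Adj
  | Sum.inl u, Sum.inl v => inferInstanceAs (Decidable (G.Adj u v))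
  | Sum.inl u, Sum.inr e => inferInstanceAs (Decidable (u = f e))
  | Sum.inr e, Sum.inl u => inferInstanceAs (Decidable (u = f e))
  | Sum.inr _, Sum.inr _ => inferInstanceAs (Decidable False)

instance (m : ℕ) : DecidableRel (SimpleGraph.pathGraph m).Adj := fun _ _ =>
  decidable_of_iff _ SimpleGraph.pathGraph_adj.symm

/-- The vertices of `C(r₁, …, r_n)`: those of the path `P_{2n+1}`, and `r_i` new ones
for each `i`. -/
abbrev CVertex {n : ℕ} (r : Fin n → ℕ) : Type := Fin (2 * n + 1) ⊕ (Σ i : Fin n, Fin (r i))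

/-- The tree `C(r₁, …, r_n)`: `r_i` new vertices are attached to the vertex `v_{2i}` of the path
`v₁, …, v_{2n+1}`. With indices counted from `0`, `r i` vertices are attached to the path
vertex `2 * i + 1`. -/
def treeC {n : ℕ} (r : Fin n → ℕ) : SimpleGraph (CVertex r) :=
  attach (SimpleGraph.pathGraph (2 * n + 1)) fun e => ⟨2 * e.1.val + 1, by omega⟩

instance {n : ℕ} (r : Fin n → ℕ) : DecidableRel (treeC r).Adj :=
  inferInstanceAs (DecidableRel (attach _ _).Adj)

/-- The vertices of `C(r₁, …, r_n)` that receive a new vertex in `S(r₁, …, r_n)`: those of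
degree `1`, and the path vertices `v₃, v₅, …, v_{2n-1}`. With indices counted from `0`, the
latter are the path vertices `2 * i` with `1 ≤ i < n`. -/
def Extended {n : ℕ} (r : Fin n → ℕ) (v : CVertex r) : Prop :=
  (treeC r).degree v = 1 ∨
    ∃ (i : Fin n) (_ : 1 ≤ i.val), v = Sum.inl ⟨2 * i.val, by omega⟩

instance {n : ℕ} (r : Fin n → ℕ) : DecidablePred (Extended r) := fun _ =>
  inferInstanceAs (Decidable (_ ∨ _))

/-- The tree `S(r₁, …, r_n)`: one new vertex is attached to each vertex of `C(r₁, …, r_n)` that is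
of degree `1` or one of `v₃, v₅, …, v_{2n-1}`. -/
def treeS {n : ℕ} (r : Fin n → ℕ) : SimpleGraph (CVertex r ⊕ {v : CVertex r // Extended r v}) :=
  attach (treeC r) Subtype.val

end IntegralTrees

/-! `treeC` is bipartite with the n centers v_2, v_4, … as one class, and `treeS` hangs a leaf on
each vertex of the other class. If B is the biadjacency matrix, then B Bᵀ is the Jacobi matrix J
with diagonal r_i + 2 and off-diagonal 1, and each eigenvalue t of J gives the eigenvalue √(t + 1)
of `treeS`. Integrality would thus force every eigenvalue of J to be k_i² - 1 with k_i ≥ 1 an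
integer.

This is impossible (`jacobi_not_all_eigenvalues_sq`). The eigenvector for t_i with first entry 1 is
the integer vector given by `recSol`; let P_ii be its squared norm. Eigenvectors for t_i and t_j are
orthogonal and congruent modulo t_i - t_j, so k_i² - k_j² divides P_ii. Some j makes this difference
exceed n, whence P_ii > n. But 1/P_ii is the squared first entry of the i-th unit eigenvector, and
these sum to 1 over i. -/

open Matrix Finset

namespace IntegralTrees

/-! ### Spectra of integer Jacobi matrices. -/

section Jacobi

/-- A vector extended by zero to a sequence, with its entries moved to the indices `1, …, n`. -/
def shift {n : ℕ} (x : Fin n → ℝ) (k : ℕ) : ℝ := ∑ j : Fin n, if (j : ℕ) + 1 = k then x j else 0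

lemma shift_succ {n : ℕ} (x : Fin n → ℝ) {k : ℕ} (hk : k < n) : shift x (k + 1) = x ⟨k, hk⟩ := by
  unfold shift
  rw [Finset.sum_eq_single ⟨k, hk⟩]
  · simp
  · intro b _ hb
    rw [if_neg]
    intro h
    exact hb (Fin.ext (by simpa using h))
  · simp

lemma shift_zero {n : ℕ} (x : Fin n → ℝ) : shift x 0 = 0 := by simp [shift]

lemma shift_of_lt {n : ℕ} (x : Fin n → ℝ) {k : ℕ} (hk : n < k) : shift x k = 0 := by
  unfold shift
  refine Finset.sum_eq_zero fun j _ => if_neg ?_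
  omega

/-- The tridiagonal matrix with diagonal `d` and with all entries next to the diagonal `1`. -/
def jacobi (n : ℕ) (d : ℕ → ℤ) : Matrix (Fin n) (Fin n) ℝ := fun i j =>
  (if j = i then (d i : ℝ) else 0) + (if (j : ℕ) + 1 = i then 1 else 0) +
    (if (j : ℕ) + 1 = i + 2 then 1 else 0)

lemma jacobi_mulVec {n : ℕ} (d : ℕ → ℤ) (x : Fin n → ℝ) (i : Fin n) :
    (jacobi n d *ᵥ x) i = d i * x i + shift x i + shift x (i + 2) := by
  simp only [Matrix.mulVec, dotProduct, jacobi, add_mul, Finset.sum_add_distrib, ite_mul, zero_mul,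
    one_mul, shift]
  simp

lemma jacobi_isHermitian (n : ℕ) (d : ℕ → ℤ) : (jacobi n d).IsHermitian := by
  refine Matrix.IsHermitian.ext fun i j => ?_
  simp only [jacobi, star_trivial]
  by_cases h : i = j
  · subst h; rfl
  · have h' : ¬ j = i := fun e => h e.symm
    simp only [h, h', if_false]
    have e1 : ((j : ℕ) + 1 = i + 2) ↔ ((i : ℕ) + 1 = j) := by omega
    have e2 : ((i : ℕ) + 1 = j + 2) ↔ ((j : ℕ) + 1 = i) := by omega
    simp only [e1, e2]
    ring

/-- The solution of the three-term recurrence of a Jacobi matrix that starts with `0`, `1`. -/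
def recSol (d : ℕ → ℤ) (t : ℤ) : ℕ → ℤ
  | 0 => 0
  | 1 => 1
  | k + 2 => (t - d k) * recSol d t (k + 1) - recSol d t k

lemma recSol_modEq (d : ℕ → ℤ) (s t : ℤ) (k : ℕ) : s - t ∣ recSol d s k - recSol d t k := by
  induction k using Nat.twoStepInduction with
  | zero => simp [recSol]
  | one => simp [recSol]
  | more k h0 h1 =>
    have : recSol d s (k + 2) - recSol d t (k + 2) =
        (s - t) * recSol d s (k + 1) + (t - d k) * (recSol d s (k + 1) - recSol d t (k + 1)) -
          (recSol d s k - recSol d t k) := by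
      simp only [recSol]; ring
    rw [this]
    exact dvd_sub (dvd_add (dvd_mul_right _ _) (Dvd.dvd.mul_left h1 _)) h0

/-- Extension by zero makes the first and last rows obey the same recurrence as the others. -/
lemma shift_rec {n : ℕ} {d : ℕ → ℤ} {x : Fin n → ℝ} {t : ℝ} (h : jacobi n d *ᵥ x = t • x)
    {k : ℕ} (hk : k < n) : shift x (k + 2) = (t - d k) * shift x (k + 1) - shift x k := by
  have := congrFun h ⟨k, hk⟩
  rw [jacobi_mulVec] at this
  rw [shift_succ x hk]
  simp only [Pi.smul_apply, smul_eq_mul] at this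
  linarith

lemma shift_eq_recSol {n : ℕ} {d : ℕ → ℤ} {x : Fin n → ℝ} {t : ℤ}
    (h : jacobi n d *ᵥ x = (t : ℝ) • x) (k : ℕ) (hk : k ≤ n) :
    shift x k = shift x 1 * recSol d t k := by
  induction k using Nat.twoStepInduction with
  | zero => simp [recSol, shift_zero]
  | one => simp [recSol]
  | more k h0 h1 =>
    rw [shift_rec h (by omega), h0 (by omega), h1 (by omega)]
    simp only [recSol]
    push_cast
    ring

lemma eigenvector_eq_zero {n : ℕ} {d : ℕ → ℤ} {x : Fin n → ℝ} {t : ℝ}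
    (h : jacobi n d *ᵥ x = t • x) (h1 : shift x 1 = 0) : x = 0 := by
  have key : ∀ k ≤ n, shift x k = 0 := by
    intro k hk
    induction k using Nat.twoStepInduction with
    | zero => exact shift_zero x
    | one => exact h1
    | more k i0 i1 => rw [shift_rec h (by omega), i0 (by omega), i1 (by omega)]; ring
  funext i
  have := key (i + 1) i.2
  rwa [shift_succ x i.2] at this

/-- Among n distinct positive integers some k_b is at least n, and then |k_a² - k_b²| ≥ k_a + k_b >
n for every a ≠ b. Pair i with such a b, or with any other index if i is b itself. -/
lemma exists_lt_abs_sq_sub_sq {n : ℕ} (hn : 2 ≤ n) (k : Fin n → ℤ) (hk : Function.Injective k)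
    (hpos : ∀ i, 1 ≤ k i) (i : Fin n) : ∃ j, j ≠ i ∧ (n : ℤ) < |k i ^ 2 - k j ^ 2| := by
  have big : ∃ j, (n : ℤ) ≤ k j := by
    by_contra! hlt
    have := Finset.card_le_card_of_injOn (s := (Finset.univ : Finset (Fin n)))
      (t := Finset.Icc (1 : ℤ) (n - 1)) k
      (fun j _ => by have := hpos j; have := hlt j; simp; omega) (hk.injOn)
    simp at this
    omega
  have gap : ∀ a b : Fin n, a ≠ b → (n : ℤ) ≤ k b → (n : ℤ) < |k a ^ 2 - k b ^ 2| := by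
    intro a b hab hb
    have ha := hpos a
    have hne : k a - k b ≠ 0 := sub_ne_zero.2 fun e => hab (hk e)
    have h1 : 1 ≤ |k a - k b| := Int.one_le_abs hne
    have h2 : |k a ^ 2 - k b ^ 2| = |k a - k b| * (k a + k b) := by
      rw [← abs_of_nonneg (show 0 ≤ k a + k b by omega), ← abs_mul]
      congr 1; ring
    rw [h2]
    nlinarith
  obtain ⟨j, hj⟩ := big
  by_cases hij : j = i
  · subst hij
    have : Nontrivial (Fin n) := Fin.nontrivial_iff_two_le.2 hn
    obtain ⟨l, hl⟩ := exists_ne j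
    exact ⟨l, hl, by rw [abs_sub_comm]; exact gap l j hl hj⟩
  · exact ⟨j, hij, gap i j (Ne.symm hij) hj⟩

/-- The eigenvalues of a tridiagonal integer matrix with all entries next to the diagonal `1`
are not all one less than a positive square. -/
theorem jacobi_not_all_eigenvalues_sq {n : ℕ} (hn : 2 ≤ n) (d : ℕ → ℤ) :
    ¬ ∀ (t : ℝ) (x : Fin n → ℝ), x ≠ 0 → jacobi n d *ᵥ x = t • x →
      ∃ m : ℤ, 1 ≤ m ∧ t + 1 = (m : ℝ) ^ 2 := by
  intro H
  have hT := jacobi_isHermitian n d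
  let u := hT.eigenvectorBasis
  have hu : ∀ i, jacobi n d *ᵥ (u i).ofLp = hT.eigenvalues i • (u i).ofLp :=
    hT.mulVec_eigenvectorBasis
  have hu0 : ∀ i, (u i).ofLp ≠ 0 := fun i h =>
    u.orthonormal.ne_zero i (by ext j; simpa using congrFun h j)
  choose k hk1 hk using fun i => H _ _ (hu0 i) (hu i)
  let t : Fin n → ℤ := fun i => k i ^ 2 - 1
  have ht : ∀ i, hT.eigenvalues i = (t i : ℝ) := by
    intro i; simp only [t]; push_cast; linarith [hk i]
  let c : Fin n → ℝ := fun i => shift (u i).ofLp 1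
  have hc : ∀ i (j : Fin n), (u i).ofLp j = c i * recSol d (t i) (j + 1) := by
    intro i j
    have h := hu i
    rw [ht i] at h
    rw [← shift_eq_recSol h (j + 1) j.2, shift_succ _ j.2]
  have hc0 : ∀ i, c i ≠ 0 := fun i h => hu0 i (eigenvector_eq_zero (hu i) h)
  let P : Fin n → Fin n → ℤ := fun i i' =>
    ∑ j : Fin n, recSol d (t i) (j + 1) * recSol d (t i') (j + 1)
  have hin : ∀ i i', c i * c i' * (P i i' : ℝ) = if i = i' then 1 else 0 := by
    intro i i'
    rw [← u.inner_eq_ite i i']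
    simp only [PiLp.inner_apply, hc, P]
    push_cast
    rw [Finset.mul_sum]
    refine Finset.sum_congr rfl fun j _ => ?_
    simp
    ring
  -- The spectrum is simple: equal eigenvalues would give proportional eigenvectors, which cannot be
  -- orthogonal.
  have hinj : Function.Injective k := by
    intro i i' h
    by_contra hne
    have h1 := hin i i'
    have h2 := hin i i
    have e : P i i' = P i i := by simp only [P, t, h]
    rw [if_neg hne, e] at h1
    rw [if_pos rfl] at h2
    have : (P i i : ℝ) ≠ 0 := by
      intro h3; rw [h3] at h2; simp at h2
    exact (mul_ne_zero (mul_ne_zero (hc0 i) (hc0 i')) this) h1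
  have hP : ∀ i, (n : ℤ) < P i i := by
    intro i
    obtain ⟨j, hj, hlt⟩ := exists_lt_abs_sq_sub_sq hn k hinj hk1 i
    have h0 : P i j = 0 := by
      have h1 := hin i j
      rw [if_neg (Ne.symm hj)] at h1
      simpa [hc0] using h1
    -- Subtracting P i j = 0 changes only the second factor of each product, and that change is
    -- divisible by t i - t j.
    have hdvd : k i ^ 2 - k j ^ 2 ∣ P i i := by
      have e : P i i = ∑ l : Fin n, recSol d (t i) (l + 1) *
          (recSol d (t i) (l + 1) - recSol d (t j) (l + 1)) := by
        rw [← sub_zero (P i i), ← h0]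
        simp only [P, ← Finset.sum_sub_distrib, mul_sub]
      rw [e]
      refine Finset.dvd_sum fun l _ => Dvd.dvd.mul_left ?_ _
      have := recSol_modEq d (t i) (t j) (l + 1)
      rwa [show t i - t j = k i ^ 2 - k j ^ 2 by simp only [t]; ring] at this
    have hpos : 0 < P i i := by
      have h2 := hin i i
      rw [if_pos rfl] at h2
      have hne : P i i ≠ 0 := by
        intro h3; rw [h3] at h2; simp at h2
      have : 0 ≤ P i i := Finset.sum_nonneg fun l _ => mul_self_nonneg _
      omega
    exact lt_of_lt_of_le hlt (Int.le_of_dvd hpos ((abs_dvd _ _).2 hdvd))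
  -- Parseval for the first standard basis vector.
  have hpars : ∑ i, c i ^ 2 = 1 := by
    have h := u.sum_sq_norm_inner_right (EuclideanSpace.single ⟨0, by omega⟩ (1 : ℝ))
    simp only [EuclideanSpace.inner_single_right, PiLp.norm_single] at h
    simpa [c, shift_succ _ (show 0 < n by omega)] using h
  have hlt : ∀ i, n * c i ^ 2 < 1 := by
    intro i
    have h2 := hin i i
    rw [if_pos rfl] at h2
    have h3 : (n : ℝ) < P i i := by exact_mod_cast hP i
    have h4 : 0 < c i ^ 2 := by have := hc0 i; positivity
    nlinarith
  have : ∑ i, (n : ℝ) * c i ^ 2 < ∑ _i : Fin n, (1 : ℝ) :=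
    Finset.sum_lt_sum_of_nonempty ⟨⟨0, by omega⟩, Finset.mem_univ _⟩ fun i _ => hlt i
  rw [← Finset.mul_sum, hpars] at this
  simp at this

end Jacobi

/-! ### Adjacency eigenvectors and pendant vertices. -/

section Graph

/-- The sum of `f` over the neighbors of a vertex. -/
noncomputable def nbrSum {V : Type*} [Fintype V] (G : SimpleGraph V) (f : V → ℝ) (v : V) : ℝ :=
  open Classical in ∑ u, if G.Adj v u then f u else 0

lemma adjMatrix_mulVec_eq_nbrSum {V : Type*} [Fintype V] (G : SimpleGraph V) [DecidableRel G.Adj]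
    (f : V → ℝ) : G.adjMatrix ℝ *ᵥ f = nbrSum G f := by
  classical
  funext v
  simp only [Matrix.mulVec, dotProduct, nbrSum, SimpleGraph.adjMatrix_apply, ite_mul, one_mul,
    zero_mul]
  refine Finset.sum_congr rfl fun u _ => ?_
  congr

lemma hasEigenvalue_of_nbrSum {V : Type*} [Fintype V] [DecidableEq V] (G : SimpleGraph V)
    [DecidableRel G.Adj] {f : V → ℝ} {t : ℝ} (hf0 : f ≠ 0) (hf : nbrSum G f = t • f) :
    Module.End.HasEigenvalue (Matrix.toLin' (G.adjMatrix ℝ)) t :=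
  Module.End.hasEigenvalue_of_hasEigenvector (x := f)
    ⟨Module.End.mem_eigenspace_iff.2 (by
      rw [Matrix.toLin'_apply, adjMatrix_mulVec_eq_nbrSum, hf]), hf0⟩

lemma nbrSum_linear {V : Type*} [Fintype V] (G : SimpleGraph V) (a b : ℝ) (f g : V → ℝ) (v : V) :
    nbrSum G (fun u => a * f u + b * g u) v = a * nbrSum G f v + b * nbrSum G g v := by
  classical
  simp only [nbrSum, Finset.mul_sum, ← Finset.sum_add_distrib]
  refine Finset.sum_congr rfl fun u _ => ?_
  split_ifs <;> ring

lemma sum_mul_nbrSum_comm {V : Type*} [Fintype V] (G : SimpleGraph V) (f g : V → ℝ) :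
    ∑ v, f v * nbrSum G g v = ∑ v, nbrSum G f v * g v := by
  classical
  simp only [nbrSum, Finset.mul_sum, Finset.sum_mul]
  rw [Finset.sum_comm]
  refine Finset.sum_congr rfl fun u _ => Finset.sum_congr rfl fun v _ => ?_
  simp only [G.adj_comm u v]
  split_ifs <;> ring

lemma nbrSum_attach_inl {V ι : Type*} [Fintype V] [Fintype ι] [DecidableEq V] (G : SimpleGraph V)
    (p : ι → V) (f : V ⊕ ι → ℝ) (v : V) :
    nbrSum (attach G p) f (Sum.inl v) =
      nbrSum G (fun u => f (Sum.inl u)) v + ∑ e, if v = p e then f (Sum.inr e) else 0 := by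
  classical
  simp only [nbrSum, Fintype.sum_sum_type]
  congr 1
  refine Finset.sum_congr rfl fun e _ => ?_
  congr

lemma nbrSum_attach_inr {V ι : Type*} [Fintype V] [Fintype ι] (G : SimpleGraph V)
    (p : ι → V) (f : V ⊕ ι → ℝ) (e : ι) :
    nbrSum (attach G p) f (Sum.inr e) = f (Sum.inl (p e)) := by
  classical
  have h1 : ∀ u, (attach G p).Adj (Sum.inr e) (Sum.inl u) ↔ u = p e := fun u => Iff.rfl
  have h2 : ∀ e', ¬ (attach G p).Adj (Sum.inr e) (Sum.inr e') := fun e' h => h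
  simp [nbrSum, Fintype.sum_sum_type, h1, h2]

lemma nbrSum_pathGraph {m : ℕ} (f : Fin m → ℝ) (k : Fin m) :
    nbrSum (SimpleGraph.pathGraph m) f k = shift f k + shift f (k + 2) := by
  classical
  simp only [nbrSum, shift, ← Finset.sum_add_distrib, SimpleGraph.pathGraph_adj]
  refine Finset.sum_congr rfl fun j _ => ?_
  split_ifs with h1 h2 h3 <;> first | omega | simp

/-- Attaching a pendant vertex to each vertex of one color class of a bipartite graph turns an
eigenvalue `t` of its squared adjacency matrix into the eigenvalues `±√(t + 1)`. -/
lemma exists_int_sq_of_integralGraph_attach {V : Type*} [Fintype V] (G : SimpleGraph V)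
    (p : V → Prop) [Fintype {v // p v}] (hG : IntegralGraph (attach G (Subtype.val : {v // p v} → V)))
    {g h : V → ℝ} {t : ℝ} (hh : nbrSum G h = g) (hg : nbrSum G g = t • h)
    (hp : ∀ v, p v → h v = 0) (hnp : ∀ v, ¬ p v → g v = 0) (hg0 : g ≠ 0) :
    ∃ m : ℤ, 1 ≤ m ∧ t + 1 = (m : ℝ) ^ 2 := by
  classical
  -- By symmetry of the adjacency matrix, t‖h‖² = ‖g‖² > 0.
  have hnonneg : 0 ≤ t := by
    have e : t * ∑ v, h v * h v = ∑ v, g v * g v := by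
      have := sum_mul_nbrSum_comm G h g
      rw [hg, hh] at this
      rw [← this, Finset.mul_sum]
      refine Finset.sum_congr rfl fun v _ => ?_
      simp only [Pi.smul_apply, smul_eq_mul]; ring
    have h1 : 0 < ∑ v, g v * g v := by
      obtain ⟨v, hv⟩ := Function.ne_iff.1 hg0
      exact Finset.sum_pos' (fun _ _ => mul_self_nonneg _)
        ⟨v, Finset.mem_univ _, mul_self_pos.2 hv⟩
    have h2 : 0 ≤ ∑ v, h v * h v := Finset.sum_nonneg fun _ _ => mul_self_nonneg _
    by_contra! hneg
    nlinarith
  set μ := √(t + 1) with hμ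
  have hμ2 : μ ^ 2 = t + 1 := Real.sq_sqrt (by linarith)
  have hμpos : 0 < μ := Real.sqrt_pos.2 (by linarith)
  -- On the class `p`, where h vanishes, f is μ g, so each new leaf must carry g. At old vertices
  -- the leaf turns t g into (t + 1) g = μ² g.
  let f : V ⊕ {v // p v} → ℝ := Sum.elim (fun v => t * h v + μ * g v) fun e => g e.1
  have hf : nbrSum (attach G (Subtype.val : {v // p v} → V)) f = μ • f := by
    funext w
    rcases w with v | e
    · rw [nbrSum_attach_inl]
      simp only [f, Sum.elim_inl, Sum.elim_inr, Pi.smul_apply, smul_eq_mul]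
      rw [nbrSum_linear, hh, hg]
      have hs : (∑ e : {v // p v}, if v = e.1 then g e.1 else 0) = g v := by
        by_cases hv : p v
        · rw [Finset.sum_eq_single ⟨v, hv⟩]
          · simp
          · intro b _ hb
            exact if_neg fun e => hb (Subtype.ext e.symm)
          · simp
        · rw [hnp v hv]
          refine Finset.sum_eq_zero fun e _ => if_neg ?_
          rintro rfl
          exact hv e.2
      rw [hs]
      simp only [Pi.smul_apply, smul_eq_mul]
      linear_combination (- g v) * hμ2
    · rw [nbrSum_attach_inr]
      simp only [f, Sum.elim_inl, Sum.elim_inr, Pi.smul_apply, smul_eq_mul]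
      rw [hp e.1 e.2]; ring
  have hf0 : f ≠ 0 := by
    obtain ⟨v, hv⟩ := Function.ne_iff.1 hg0
    have hpv : p v := by_contra fun hc => hv (hnp v hc)
    exact fun h0 => hv (congrFun h0 (Sum.inr ⟨v, hpv⟩))
  obtain ⟨m, hm⟩ := hG μ (by convert hasEigenvalue_of_nbrSum _ hf0 hf)
  refine ⟨m, ?_, by rw [← hm, hμ2]⟩
  have : (0 : ℝ) < m := hm ▸ hμpos
  exact_mod_cast this

end Graph

/-! ### The caterpillar `treeC` and its Jacobi matrix. -/

section Tree

variable {n : ℕ} (r : Fin n → ℕ)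

lemma nbrSum_treeC_inl (f : CVertex r → ℝ) (k : Fin (2 * n + 1)) :
    nbrSum (treeC r) f (Sum.inl k) = shift (fun j => f (Sum.inl j)) k +
      shift (fun j => f (Sum.inl j)) (k + 2) +
      ∑ i : Fin n, if (k : ℕ) = 2 * i + 1 then ∑ a : Fin (r i), f (Sum.inr ⟨i, a⟩) else 0 := by
  rw [treeC, nbrSum_attach_inl, nbrSum_pathGraph, Fintype.sum_sigma]
  congr 1
  refine Finset.sum_congr rfl fun i _ => ?_
  simp only [Fin.ext_iff]
  split_ifs <;> simp

lemma nbrSum_treeC_inr (f : CVertex r → ℝ) (e : Σ i : Fin n, Fin (r i)) :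
    nbrSum (treeC r) f (Sum.inr e) = f (Sum.inl ⟨2 * e.1.val + 1, by omega⟩) := by
  rw [treeC, nbrSum_attach_inr]

lemma sum_ite_odd (F : Fin n → ℝ) (i : Fin n) :
    (∑ j : Fin n, if 2 * (i : ℕ) + 1 = 2 * j + 1 then F j else 0) = F i := by
  rw [Finset.sum_eq_single i]
  · simp
  · intro b _ hb
    exact if_neg fun h => hb (Fin.ext (by omega))
  · simp

lemma sum_ite_even (F : Fin n → ℝ) (k : ℕ) :
    (∑ j : Fin n, if 2 * k = 2 * (j : ℕ) + 1 then F j else 0) = 0 :=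
  Finset.sum_eq_zero fun _ _ => if_neg (by omega)

lemma degree_treeC (v : CVertex r) :
    ((treeC r).degree v : ℝ) = nbrSum (treeC r) (fun _ => 1) v := by
  rw [← adjMatrix_mulVec_eq_nbrSum]
  have := SimpleGraph.adjMatrix_mulVec_const_apply (G := treeC r) (a := (1 : ℝ)) (v := v)
  rw [mul_one] at this
  exact this.symm

lemma extended_inr (e : Σ i : Fin n, Fin (r i)) : Extended r (Sum.inr e) := by
  left
  have := degree_treeC r (Sum.inr e)
  rw [nbrSum_treeC_inr] at this
  exact_mod_cast this

lemma extended_even (hn : 2 ≤ n) (k : ℕ) (hk : k ≤ n) :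
    Extended r (Sum.inl ⟨2 * k, by omega⟩) := by
  by_cases h : 1 ≤ k ∧ k < n
  · exact Or.inr ⟨⟨k, h.2⟩, h.1, rfl⟩
  · left
    have hd := degree_treeC r (Sum.inl ⟨2 * k, by omega⟩)
    have h1 : nbrSum (treeC r) (fun _ => 1) (Sum.inl ⟨2 * k, by omega⟩) = 1 := by
      rw [nbrSum_treeC_inl]
      simp only [sum_ite_even]
      rcases Nat.eq_zero_or_pos k with rfl | hk0
      · rw [mul_zero, shift_zero, zero_add, shift_succ _ (by omega), add_zero]
      · obtain rfl : k = n := by omega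
        obtain ⟨m, rfl⟩ : ∃ m, k = m + 1 := ⟨k - 1, by omega⟩
        rw [shift_of_lt _ (show 2 * (m + 1) + 1 < 2 * (m + 1) + 2 by omega),
          show shift _ (2 * (m + 1)) = shift _ (2 * m + 1 + 1) from rfl, shift_succ _ (by omega),
          add_zero, add_zero]
    rw [h1] at hd
    exact_mod_cast hd

lemma not_extended_odd (i : Fin n) : ¬ Extended r (Sum.inl ⟨2 * i.val + 1, by omega⟩) := by
  rintro (h | ⟨j, _, h⟩)
  · have hd := degree_treeC r (Sum.inl ⟨2 * i.val + 1, by omega⟩)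
    rw [nbrSum_treeC_inl] at hd
    simp only [sum_ite_odd] at hd
    rw [shift_succ _ (by omega), shift_succ _ (by omega), h] at hd
    simp at hd
    have : (0 : ℝ) ≤ r i := Nat.cast_nonneg _
    linarith
  · have := congrArg Fin.val (Sum.inl.inj h)
    simp only at this
    omega

/-- A vector on the even-indexed path vertices, extended by zero. -/
noncomputable def centerVec (x : Fin n → ℝ) : CVertex r → ℝ :=
  Sum.elim (fun k => if Even k.val then 0 else shift x ((k.val + 1) / 2)) fun _ => 0

/-- The image of `centerVec r x` under the adjacency matrix of `treeC r`. -/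
noncomputable def outerVec (x : Fin n → ℝ) : CVertex r → ℝ :=
  Sum.elim (fun k => if Even k.val then shift x (k.val / 2) + shift x (k.val / 2 + 1) else 0)
    fun e => x e.1

lemma shift_centerVec_even (x : Fin n → ℝ) (k : ℕ) (hk : k ≤ n + 1) :
    shift (fun j => centerVec r x (Sum.inl j)) (2 * k) = shift x k := by
  rcases Nat.eq_zero_or_pos k with rfl | hk0
  · rw [mul_zero, shift_zero, shift_zero]
  · obtain ⟨m, rfl⟩ : ∃ m, k = m + 1 := ⟨k - 1, by omega⟩
    rcases Nat.lt_or_ge m n with hm | hm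
    · rw [show 2 * (m + 1) = 2 * m + 1 + 1 by ring, shift_succ _ (by omega)]
      have : ¬ Even (2 * m + 1) := by simp
      simp only [centerVec, Sum.elim_inl, this, if_false]
      congr 1; omega
    · rw [shift_of_lt _ (by omega), shift_of_lt _ (by omega)]

lemma shift_centerVec_odd (x : Fin n → ℝ) (k : ℕ) :
    shift (fun j => centerVec r x (Sum.inl j)) (2 * k + 1) = 0 := by
  rcases Nat.lt_or_ge (2 * k) (2 * n + 1) with hm | hm
  · rw [shift_succ _ hm]
    simp [centerVec]
  · exact shift_of_lt _ (by omega)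

lemma shift_outerVec_odd (x : Fin n → ℝ) (k : ℕ) (hk : k ≤ n) :
    shift (fun j => outerVec r x (Sum.inl j)) (2 * k + 1) = shift x k + shift x (k + 1) := by
  rw [shift_succ _ (by omega)]
  simp [outerVec]

lemma shift_outerVec_even (x : Fin n → ℝ) (k : ℕ) :
    shift (fun j => outerVec r x (Sum.inl j)) (2 * k) = 0 := by
  rcases Nat.eq_zero_or_pos k with rfl | hk0
  · exact shift_zero _
  · obtain ⟨m, rfl⟩ : ∃ m, k = m + 1 := ⟨k - 1, by omega⟩
    rcases Nat.lt_or_ge m n with hm | hm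
    · rw [show 2 * (m + 1) = 2 * m + 1 + 1 by ring, shift_succ _ (by omega)]
      have : ¬ Even (2 * m + 1) := by simp
      simp [outerVec, this]
    · exact shift_of_lt _ (by omega)

lemma nbrSum_centerVec (x : Fin n → ℝ) : nbrSum (treeC r) (centerVec r x) = outerVec r x := by
  funext v
  rcases v with ⟨k, hk⟩ | e
  · rw [nbrSum_treeC_inl]
    have h0 : ∀ e, centerVec r x (Sum.inr e) = 0 := fun _ => rfl
    simp only [h0, Finset.sum_const_zero, ite_self, add_zero]
    rcases Nat.even_or_odd' k with ⟨m, rfl | rfl⟩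
    · rw [shift_centerVec_even r x m (by omega), show 2 * m + 2 = 2 * (m + 1) by ring,
        shift_centerVec_even r x (m + 1) (by omega)]
      simp [outerVec]
    · rw [shift_centerVec_odd, show 2 * m + 1 + 2 = 2 * (m + 1) + 1 by ring, shift_centerVec_odd]
      have : ¬ Even (2 * m + 1) := by simp
      simp [outerVec, this]
  · rw [nbrSum_treeC_inr]
    have : ¬ Even (2 * e.1.val + 1) := by simp
    simp only [centerVec, outerVec, Sum.elim_inl, Sum.elim_inr, this, if_false]
    rw [show (2 * e.1.val + 1 + 1) / 2 = e.1.val + 1 by omega, shift_succ _ e.1.2]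

/-- This is B Bᵀ = J: the pendant vertices at a center return r_i x_i, and its two path neighbors
return 2 x_i plus the values of x at the adjacent centers. -/
lemma nbrSum_outerVec {d : ℕ → ℤ} (hd : ∀ i : Fin n, d i = r i + 2) {x : Fin n → ℝ} {t : ℝ}
    (h : jacobi n d *ᵥ x = t • x) : nbrSum (treeC r) (outerVec r x) = t • centerVec r x := by
  funext v
  rcases v with ⟨k, hk⟩ | e
  · rw [nbrSum_treeC_inl]
    simp only [Pi.smul_apply, smul_eq_mul]
    rcases Nat.even_or_odd' k with ⟨m, rfl | rfl⟩
    · simp only [sum_ite_even]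
      rw [shift_outerVec_even, show 2 * m + 2 = 2 * (m + 1) by ring, shift_outerVec_even]
      simp [centerVec]
    · have hm : m < n := by omega
      have hs := sum_ite_odd (fun i => ∑ a : Fin (r i), outerVec r x (Sum.inr ⟨i, a⟩)) ⟨m, hm⟩
      simp only at hs
      simp only [hs]
      rw [shift_outerVec_odd r x m (by omega), show 2 * m + 1 + 2 = 2 * (m + 1) + 1 by ring,
        shift_outerVec_odd r x (m + 1) (by omega)]
      have : ¬ Even (2 * m + 1) := by simp
      simp only [centerVec, outerVec, Sum.elim_inl, Sum.elim_inr, this, if_false]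
      rw [show (2 * m + 1 + 1) / 2 = m + 1 by omega, shift_rec h hm, shift_succ _ hm]
      have := hd ⟨m, hm⟩
      simp only at this
      simp [this]
      ring
  · rw [nbrSum_treeC_inr]
    have : ¬ Even (2 * e.1.val + 1) := by simp
    simp [centerVec, outerVec, this]

end Tree

theorem not_integralGraph_treeS {n : ℕ} (hn : 2 ≤ n) (r : Fin n → ℕ) :
    ¬ IntegralGraph (treeS r) := by
  intro hS
  -- The value 0 beyond the range is never read by `jacobi n d`.
  let d : ℕ → ℤ := fun k => if hk : k < n then r ⟨k, hk⟩ + 2 else 0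
  have hd : ∀ i : Fin n, d i = r i + 2 := fun i => by simp [d]
  refine jacobi_not_all_eigenvalues_sq hn d fun t x hx h => ?_
  refine exists_int_sq_of_integralGraph_attach (treeC r) (Extended r) hS (nbrSum_centerVec r x)
    (nbrSum_outerVec r hd h) ?_ ?_ ?_
  · rintro (⟨k, hk⟩ | e) hv
    · rcases Nat.even_or_odd' k with ⟨m, rfl | rfl⟩
      · simp [centerVec]
      · exact absurd hv (not_extended_odd r ⟨m, by omega⟩)
    · rfl
  · rintro (⟨k, hk⟩ | e) hv
    · rcases Nat.even_or_odd' k with ⟨m, rfl | rfl⟩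
      · exact absurd (extended_even r hn m (by omega)) hv
      · have : ¬ Even (2 * m + 1) := by simp
        simp [outerVec, this]
    · exact absurd (extended_inr r e) hv
  · intro h0
    refine hx (eigenvector_eq_zero h ?_)
    -- At the first path vertex `outerVec` takes the first entry of x, which is nonzero for an
    -- eigenvector.
    have := congrFun h0 (Sum.inl ⟨0, by omega⟩)
    simpa [outerVec, shift_zero] using this

end IntegralTrees

theorem theorem4 (n : ℕ) (hn : 2 ≤ n) (r : Fin n → ℕ) :
    ¬ IntegralTrees.IntegralGraph (IntegralTrees.treeS r) := by
  exact IntegralTrees.not_integralGraph_treeS hn r
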